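/- Let $(\lambda_k)_{k\ge 0}$ be non-negative reals with $\lambda_0<1$ and $\sum_{k=0}^\infty\lambda_k^2=1$. On the torus $\mathbb T=\mathbb R/\mathbb Z$ put $\psi_0:=\lambda_0$ and, for $k\ge 1$, $\psi_k:=\lambda_k\cos(2\pi k\,\cdot)$, $\psi_{-k}:=\lambda_k\sin(2\pi k\,\cdot)$. For $d\in\mathbb N=\{1,2,\dots\}$ let $\mathcal H_\lambda(\mathbb T^d)$ be the real Hilbert space of functions on $\mathbb T^d$ for which the nonzero functions among $\psi_{\mathbf k}(\mathbf x)=\prod_{j=1}^d\psi_{k_j}(x_j)$, $\mathbf k\in\mathbb Z^d$, form an orthonormal basis. A deterministic algorithm of cardinality $n$ for the embedding $\mathcal H_\lambda(\mathbb T^d)\hookrightarrow L_\infty(\mathbb T^d)$ (Lebesgue measure) is a map $A_n=\phi\circ N$, where $N(f)=(y_1,\dots,y_n)$ with $y_k=L_{k;y_1,\dots,y_{k-1}}(f)$, each $L_{k;y_1,\dots,y_{k-1}}$ is a continuous linear functional on $\mathcal H_\lambda(\mathbb T^d)$ that may depend on the values $y_1,\dots,y_{k-1}$ already observed, and $\phi:\mathbb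 R^n\to L_\infty(\mathbb T^d)$ is arbitrary. Its error is $e(A_n):=\sup_{\|f\|_{\mathcal H_\lambda(\mathbb T^d)}\le 1}\|f-A_n(f)\|_{L_\infty}$. Put $e^{\det}(n,d):=\inf_{A_n}e(A_n)$, and let $n^{\det}(\varepsilon,d)\in\mathbb N_0\cup\{\infty\}$ be the least $n$ for which there is an algorithm $A_n$ of cardinality $n$ with $e(A_n)\le\varepsilon$. Then the approximation problem suffers from the curse of dimensionality in the deterministic setting: there are $\varepsilon,\gamma,c>0$ and $d_0\in\mathbb N$ such that $n^{\det}(\varepsilon,d)\ge c\,(1+\gamma)^d$ for all $d\ge d_0$. In detail, put $\beta:=\sup\bigl(\{\lambda_0^2\}\cup\{\lambda_k^2/2: k\ge 1\}\bigr)$. Then $\beta\in(0,1)$, and for all $d\in\mathbb N$ we have $e^{\det}(0,d)=1$, $$e^{\det}(n,d)\ \ge\ \sqrt{(1-n\,\beta^d)_+}\qquad\text{for all } n\in\mathbb N_0,$$ and $$n^{\det}(\varepsilon,d)\ \ge\ \beta^{-d}(1-\varepsilon)^2\qquad\text{for all }\varepsilon\in(0,1).$$ -/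

import Mathlib

open scoped ENNReal NNReal

noncomputable section

/-! ### Deterministic algorithms, minimal errors and complexity -/

namespace IBC

/-- A deterministic algorithm of cardinality `n` with input space `E` and output space `G`: it
evaluates `n` continuous linear functionals, chosen adaptively, and then forms an output.
`functional k y` is the functional that is evaluated after the values
`y = (y_1, …, y_k)` have been observed (only `k < n` is ever used), and `output` turns the
information vector into an output.  Neither map is restricted in any other way. -/
structure DetAlgorithm (E G : Type*) [NormedAddCommGroup E] [NormedSpace ℝ E] (n : ℕ) where
  functional : (k : ℕ) → (Fin k → ℝ) → (E →L[ℝ] ℝ)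
  output : (Fin n → ℝ) → G

namespace DetAlgorithm

variable {E G : Type*} [NormedAddCommGroup E] [NormedSpace ℝ E] {n : ℕ}

/-- The first `k` pieces of information that the algorithm collects on the input `f`. -/
def info (A : DetAlgorithm E G n) (f : E) : (k : ℕ) → (Fin k → ℝ)
  | 0 => Fin.elim0
  | k + 1 => Fin.snoc (α := fun _ => ℝ) (A.info f k) (A.functional k (A.info f k) f)

/-- The output of the algorithm for the input `f`. -/
def run (A : DetAlgorithm E G n) (f : E) : G := A.output (A.info f n)

/-- The worst case error of the algorithm for the solution operator `S` on the input set `F`. -/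
def error [PseudoEMetricSpace G] (A : DetAlgorithm E G n) (S : E → G) (F : Set E) : ℝ≥0∞ :=
  ⨆ f ∈ F, edist (A.run f) (S f)

end DetAlgorithm

variable {E G : Type*} [NormedAddCommGroup E] [NormedSpace ℝ E] [PseudoEMetricSpace G]

/-- The `n`-th minimal worst case error `e^det(n, S, F)`. -/
def detError (S : E → G) (F : Set E) (n : ℕ) : ℝ≥0∞ :=
  ⨅ A : DetAlgorithm E G n, A.error S F

/-- The `ε`-complexity `n^det(ε, S, F)`: the least cardinality of an algorithm with error at
most `ε`; it is `⊤` if there is no such algorithm. -/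
def detComplexity (S : E → G) (F : Set E) (ε : ℝ) : ℕ∞ :=
  ⨅ (n : ℕ) (_ : ∃ A : DetAlgorithm E G n, A.error S F ≤ ENNReal.ofReal ε), (n : ℕ∞)

/-- The curse of dimensionality for a complexity function `N ε d` of the error tolerance `ε` and
the dimension `d`. -/
def CurseOfDimensionality (N : ℝ → ℕ → ℕ∞) : Prop :=
  ∃ ε γ c : ℝ, 0 < ε ∧ 0 < γ ∧ 0 < c ∧ ∃ d₀ : ℕ, ∀ d : ℕ, d₀ ≤ d →
    ENNReal.ofReal (c * (1 + γ) ^ d) ≤ (N ε d : ℝ≥0∞)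

end IBC

/-! ### Tensor product spaces of periodic functions -/

namespace PeriodicTensor

open MeasureTheory

/-- The function `x ↦ cos (2 π k x)` on the torus `ℝ / ℤ`. -/
def cosT (k : ℕ) (x : UnitAddCircle) : ℝ := (fourier (k : ℤ) x : ℂ).re

/-- The function `x ↦ sin (2 π k x)` on the torus `ℝ / ℤ`. -/
def sinT (k : ℕ) (x : UnitAddCircle) : ℝ := (fourier (k : ℤ) x : ℂ).im

theorem fourier_coe_eq (k : ℕ) (x : ℝ) :
    (fourier (k : ℤ) (x : UnitAddCircle) : ℂ) =
      Complex.exp (((2 * Real.pi * k * x : ℝ) : ℂ) * Complex.I) := by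
  rw [fourier_coe_apply]
  congr 1
  push_cast
  ring

theorem cosT_coe (k : ℕ) (x : ℝ) : cosT k (x : UnitAddCircle) = Real.cos (2 * Real.pi * k * x) := by
  rw [cosT, fourier_coe_eq, Complex.exp_ofReal_mul_I_re]

theorem sinT_coe (k : ℕ) (x : ℝ) : sinT k (x : UnitAddCircle) = Real.sin (2 * Real.pi * k * x) := by
  rw [sinT, fourier_coe_eq, Complex.exp_ofReal_mul_I_im]

/-- The univariate system `ψ_0 = λ_0`, `ψ_k = λ_k cos (2 π k ·)`, `ψ_{-k} = λ_k sin (2 π k ·)`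
for `k ≥ 1`. -/
def psi (l : ℕ → ℝ) (k : ℤ) (x : UnitAddCircle) : ℝ :=
  if 0 ≤ k then l k.natAbs * cosT k.natAbs x else l k.natAbs * sinT k.natAbs x

/-- The tensor product system `ψ_k(x) = ∏_j ψ_{k_j}(x_j)`, `k ∈ ℤ^d`. -/
def psiTensor (l : ℕ → ℝ) {d : ℕ} (k : Fin d → ℤ) (x : UnitAddTorus (Fin d)) : ℝ :=
  ∏ j, psi l (k j) (x j)

/-- The indices of the nonzero functions of the tensor product system. -/
abbrev Index (l : ℕ → ℝ) (d : ℕ) : Type := {k : Fin d → ℤ // psiTensor l k ≠ 0}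

theorem cosT_zero (x : UnitAddCircle) : cosT 0 x = 1 := by
  simp [cosT]

theorem cosT_sq_add_sinT_sq (k : ℕ) (x : UnitAddCircle) : cosT k x ^ 2 + sinT k x ^ 2 = 1 := by
  have h : ‖(fourier (k : ℤ) x : ℂ)‖ = 1 := by
    rw [fourier_apply]; exact Circle.norm_coe _
  have h2 := Complex.sq_norm (fourier (k : ℤ) x : ℂ)
  rw [h, Complex.normSq_apply] at h2
  simp only [cosT, sinT]
  linarith

theorem continuous_psi (l : ℕ → ℝ) (k : ℤ) : Continuous (psi l k) := by
  unfold psi cosT sinT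
  split_ifs
  · exact continuous_const.mul (Complex.continuous_re.comp (map_continuous _))
  · exact continuous_const.mul (Complex.continuous_im.comp (map_continuous _))

theorem continuous_psiTensor (l : ℕ → ℝ) {d : ℕ} (k : Fin d → ℤ) :
    Continuous (psiTensor l k) :=
  continuous_finsetProd _ fun j _ => (continuous_psi l (k j)).comp (continuous_apply j)

theorem hasSum_psi_sq {l : ℕ → ℝ} (hl : Summable fun k => l k ^ 2) (x : UnitAddCircle) :
    HasSum (fun k : ℤ => psi l k x ^ 2) (∑' k, l k ^ 2) := by
  have hl1 : Summable fun k => l (k + 1) ^ 2 := (summable_nat_add_iff 1).2 hl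
  have e1 : ∀ n : ℕ, psi l ((n : ℤ) + 1) x ^ 2 = l (n + 1) ^ 2 * cosT (n + 1) x ^ 2 := by
    intro n
    have h : ((n : ℤ) + 1).natAbs = n + 1 := by omega
    rw [psi, if_pos (by omega), h, mul_pow]
  have e2 : ∀ n : ℕ, psi l (-((n : ℤ) + 1)) x ^ 2 = l (n + 1) ^ 2 * sinT (n + 1) x ^ 2 := by
    intro n
    have h : (-((n : ℤ) + 1)).natAbs = n + 1 := by omega
    rw [psi, if_neg (by omega), h, mul_pow]
  have e0 : psi l 0 x ^ 2 = l 0 ^ 2 := by simp [psi, cosT_zero]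
  have s1 : Summable fun n : ℕ => psi l ((n : ℤ) + 1) x ^ 2 := by
    refine Summable.of_nonneg_of_le (fun _ => sq_nonneg _) (fun n => ?_) hl1
    rw [e1]
    have := cosT_sq_add_sinT_sq (n + 1) x
    nlinarith [sq_nonneg (l (n + 1)), sq_nonneg (sinT (n + 1) x)]
  have s2 : Summable fun n : ℕ => psi l (-((n : ℤ) + 1)) x ^ 2 := by
    refine Summable.of_nonneg_of_le (fun _ => sq_nonneg _) (fun n => ?_) hl1
    rw [e2]
    have := cosT_sq_add_sinT_sq (n + 1) x
    nlinarith [sq_nonneg (l (n + 1)), sq_nonneg (cosT (n + 1) x)]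
  have key := HasSum.of_add_one_of_neg_add_one (f := fun k : ℤ => psi l k x ^ 2)
    s1.hasSum s2.hasSum
  convert! key using 1
  rw [hl.tsum_eq_zero_add, e0]
  have : (∑' n : ℕ, l (n + 1) ^ 2) =
      (∑' n : ℕ, psi l ((n : ℤ) + 1) x ^ 2) + ∑' n : ℕ, psi l (-((n : ℤ) + 1)) x ^ 2 := by
    rw [← s1.tsum_add s2]
    refine tsum_congr fun n => ?_
    rw [e1, e2, ← mul_add, cosT_sq_add_sinT_sq, mul_one]
  rw [this]
  ring

theorem sum_psiTensor_sq_le {l : ℕ → ℝ} (hl : Summable fun k => l k ^ 2) {d : ℕ}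
    (x : UnitAddTorus (Fin d)) (s : Finset (Fin d → ℤ)) :
    ∑ k ∈ s, psiTensor l k x ^ 2 ≤ (∑' k, l k ^ 2) ^ d := by
  classical
  calc ∑ k ∈ s, psiTensor l k x ^ 2
      ≤ ∑ k ∈ Fintype.piFinset fun j => s.image fun k => k j, psiTensor l k x ^ 2 := by
        refine Finset.sum_le_sum_of_subset_of_nonneg (fun k hk => ?_) fun _ _ _ => sq_nonneg _
        exact Fintype.mem_piFinset.2 fun j => Finset.mem_image_of_mem _ hk
    _ = ∏ j, ∑ i ∈ s.image fun k => k j, psi l i (x j) ^ 2 := by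
        rw [Finset.prod_univ_sum]
        simp only [psiTensor, Finset.prod_pow]
    _ ≤ ∏ _j : Fin d, ∑' k, l k ^ 2 := by
        refine Finset.prod_le_prod (fun j _ => Finset.sum_nonneg fun _ _ => sq_nonneg _)
          fun j _ => ?_
        exact sum_le_hasSum _ (fun _ _ => sq_nonneg _) (hasSum_psi_sq hl (x j))
    _ = (∑' k, l k ^ 2) ^ d := by simp

theorem sum_index_sq_le {l : ℕ → ℝ} (hl : Summable fun k => l k ^ 2) {d : ℕ}
    (x : UnitAddTorus (Fin d)) (s : Finset (Index l d)) :
    ∑ k ∈ s, psiTensor l k.1 x ^ 2 ≤ (∑' k, l k ^ 2) ^ d := by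
  classical
  have := sum_psiTensor_sq_le hl x (s.map (Function.Embedding.subtype _))
  rwa [Finset.sum_map] at this

theorem integral_fourier (n : ℤ) :
    ∫ x : UnitAddCircle, (fourier n x : ℂ) = if n = 0 then 1 else 0 := by
  have h := congrFun (fourierCoeff_fourier (T := 1) n) 0
  rw [fourierCoeff, AddCircle.integral_haarAddCircle] at h
  simp only [neg_zero, fourier_zero, one_smul, inv_one] at h
  rw [h, Pi.single_apply]
  simp [eq_comm]

theorem integrable_fourier (n : ℤ) :
    Integrable (fun x : UnitAddCircle => (fourier n x : ℂ)) :=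
  (map_continuous (fourier n)).integrable_of_hasCompactSupport (HasCompactSupport.of_compactSpace _)

theorem integral_fourier_re (n : ℤ) :
    ∫ x : UnitAddCircle, (fourier n x : ℂ).re = if n = 0 then 1 else 0 := by
  have := integral_re (𝕜 := ℂ) (integrable_fourier n)
  simp only [RCLike.re_eq_complex_re] at this
  rw [this, integral_fourier]
  split_ifs <;> simp

theorem integral_fourier_im (n : ℤ) : ∫ x : UnitAddCircle, (fourier n x : ℂ).im = 0 := by
  have := integral_im (𝕜 := ℂ) (integrable_fourier n)
  simp only [RCLike.im_eq_complex_im] at this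
  rw [this, integral_fourier]
  split_ifs <;> simp

theorem integral_re_comb (a b : ℝ) {p q : ℤ} (hp : p ≠ 0) (hq : q ≠ 0) :
    ∫ x : UnitAddCircle, (a * (fourier p x : ℂ).re + b * (fourier q x : ℂ).re) = 0 := by
  have h1 : Integrable fun x : UnitAddCircle => a * (fourier p x : ℂ).re :=
    (integrable_fourier p).re.const_mul a
  have h2 : Integrable fun x : UnitAddCircle => b * (fourier q x : ℂ).re :=
    (integrable_fourier q).re.const_mul b
  rw [integral_add h1 h2,
    integral_const_mul, integral_const_mul, integral_fourier_re, integral_fourier_re,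
    if_neg hp, if_neg hq]
  simp

theorem integral_im_comb (a b : ℝ) (p q : ℤ) :
    ∫ x : UnitAddCircle, (a * (fourier p x : ℂ).im + b * (fourier q x : ℂ).im) = 0 := by
  have h1 : Integrable fun x : UnitAddCircle => a * (fourier p x : ℂ).im :=
    (integrable_fourier p).im.const_mul a
  have h2 : Integrable fun x : UnitAddCircle => b * (fourier q x : ℂ).im :=
    (integrable_fourier q).im.const_mul b
  rw [integral_add h1 h2,
    integral_const_mul, integral_const_mul, integral_fourier_im, integral_fourier_im]
  simp

theorem integral_psi_mul_psi (l : ℕ → ℝ) {k m : ℤ} (h : k ≠ m) :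
    ∫ x : UnitAddCircle, psi l k x * psi l m x = 0 := by
  have hadd : ∀ (p q : ℤ) (x : UnitAddCircle), (fourier (p + q) x : ℂ) =
      fourier p x * fourier q x := fun p q x => fourier_add
  have hsub : ∀ (p q : ℤ) (x : UnitAddCircle), (fourier (p - q) x : ℂ) =
      fourier p x * (starRingEnd ℂ) (fourier q x) := fun p q x => by
    rw [sub_eq_add_neg, fourier_add, fourier_neg]
  set p : ℕ := k.natAbs with hp
  set q : ℕ := m.natAbs with hq
  by_cases hk : 0 ≤ k <;> by_cases hm : 0 ≤ m
  · rw [← integral_re_comb (l p * l q / 2) (l p * l q / 2)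
      (p := (p : ℤ) + q) (q := (p : ℤ) - q) (by omega) (by omega)]
    refine integral_congr_ae (Filter.Eventually.of_forall fun x => ?_)
    simp only [psi, if_pos hk, if_pos hm, ← hp, ← hq, cosT, hadd, hsub, Complex.mul_re,
      Complex.conj_re, Complex.conj_im]
    ring
  · rw [← integral_im_comb (l p * l q / 2) (-(l p * l q / 2)) ((p : ℤ) + q) ((p : ℤ) - q)]
    refine integral_congr_ae (Filter.Eventually.of_forall fun x => ?_)
    simp only [psi, if_pos hk, if_neg hm, ← hp, ← hq, cosT, sinT, hadd, hsub, Complex.mul_im,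
      Complex.conj_re, Complex.conj_im]
    ring
  · rw [← integral_im_comb (l p * l q / 2) (l p * l q / 2) ((p : ℤ) + q) ((p : ℤ) - q)]
    refine integral_congr_ae (Filter.Eventually.of_forall fun x => ?_)
    simp only [psi, if_neg hk, if_pos hm, ← hp, ← hq, cosT, sinT, hadd, hsub, Complex.mul_im,
      Complex.conj_re, Complex.conj_im]
    ring
  · rw [← integral_re_comb (-(l p * l q / 2)) (l p * l q / 2)
      (p := (p : ℤ) + q) (q := (p : ℤ) - q) (by omega) (by omega)]
    refine integral_congr_ae (Filter.Eventually.of_forall fun x => ?_)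
    simp only [psi, if_neg hk, if_neg hm, ← hp, ← hq, sinT, hadd, hsub, Complex.mul_re,
      Complex.conj_re, Complex.conj_im]
    ring

theorem integral_psiTensor_mul (l : ℕ → ℝ) {d : ℕ} {k m : Fin d → ℤ} (h : k ≠ m) :
    ∫ x : UnitAddTorus (Fin d), psiTensor l k x * psiTensor l m x = 0 := by
  obtain ⟨j, hj⟩ := Function.ne_iff.1 h
  simp only [psiTensor, ← Finset.prod_mul_distrib]
  rw [integral_fintype_prod_volume_eq_prod
    (fun (j : Fin d) (y : UnitAddCircle) => psi l (k j) y * psi l (m j) y)]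
  exact Finset.prod_eq_zero (Finset.mem_univ j) (integral_psi_mul_psi l hj)

theorem integral_psiTensor_sq_pos (l : ℕ → ℝ) {d : ℕ} {k : Fin d → ℤ} (h : psiTensor l k ≠ 0) :
    0 < ∫ x : UnitAddTorus (Fin d), psiTensor l k x * psiTensor l k x := by
  obtain ⟨x, hx⟩ := Function.ne_iff.1 h
  have hc := continuous_psiTensor l k
  exact (hc.mul hc).integral_pos_of_hasCompactSupport_nonneg_nonzero
    (HasCompactSupport.of_compactSpace _) (fun y => mul_self_nonneg _)
    (x := x) (mul_self_ne_zero.2 hx)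

/-- The vector `(ψ_k(x))_k` in the sequence space `ℓ²`. -/
def feature (l : ℕ → ℝ) (hl : Summable fun k => l k ^ 2) (d : ℕ) (x : UnitAddTorus (Fin d)) :
    lp (fun _ : Index l d => ℝ) 2 :=
  ⟨fun k => psiTensor l k.1 x, memℓp_gen (by
    simp only [ENNReal.toReal_ofNat, Real.rpow_two, Real.norm_eq_abs, sq_abs]
    exact summable_of_sum_le (fun _ => sq_nonneg _) (sum_index_sq_le hl x))⟩

/-- The space `H_λ(𝕋^d)`: the Hilbert space of functions on the torus `𝕋^d` for which the nonzero
functions `ψ_k`, `k ∈ ℤ^d`, form an orthonormal basis.  An element is given by its square summable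
coefficients with respect to this basis, and is identified with a function on `𝕋^d` by the instance
`instRKHS` below; the basis is `PeriodicSpace.basis`. -/
def PeriodicSpace (l : ℕ → ℝ) (_hl : Summable fun k => l k ^ 2) (d : ℕ) : Type :=
  lp (fun _ : Index l d => ℝ) 2

section Space

variable {l : ℕ → ℝ} {hl : Summable fun k => l k ^ 2} {d : ℕ}

instance : NormedAddCommGroup (PeriodicSpace l hl d) :=
  inferInstanceAs (NormedAddCommGroup (lp (fun _ : Index l d => ℝ) 2))

instance : InnerProductSpace ℝ (PeriodicSpace l hl d) :=
  inferInstanceAs (InnerProductSpace ℝ (lp (fun _ : Index l d => ℝ) 2))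

instance : CompleteSpace (PeriodicSpace l hl d) :=
  inferInstanceAs (CompleteSpace (lp (fun _ : Index l d => ℝ) 2))

/-- The isometric isomorphism that maps an element of `H_λ(𝕋^d)` to its coefficients. -/
def coeffs : PeriodicSpace l hl d ≃ₗᵢ[ℝ] lp (fun _ : Index l d => ℝ) 2 :=
  LinearIsometryEquiv.refl ℝ (lp (fun _ : Index l d => ℝ) 2)

/-- The value at `x` of the function with coefficients `c`, that is `∑_k c_k ψ_k(x)`. -/
def evalCLM (x : UnitAddTorus (Fin d)) : PeriodicSpace l hl d →L[ℝ] ℝ :=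
  (innerSL ℝ (feature l hl d x)).comp
    (coeffs (l := l) (hl := hl) (d := d) : PeriodicSpace l hl d →L[ℝ] _)

theorem hasSum_eval (f : PeriodicSpace l hl d) (x : UnitAddTorus (Fin d)) :
    HasSum (fun k : Index l d => coeffs f k * psiTensor l k.1 x) (evalCLM x f) :=
  lp.hasSum_inner (𝕜 := ℝ) (feature l hl d x) (coeffs f)

theorem sum_coeffs_sq_le (f : PeriodicSpace l hl d) (s : Finset (Index l d)) :
    ∑ k ∈ s, coeffs f k ^ 2 ≤ ‖f‖ ^ 2 := by
  have h := lp.sum_rpow_le_norm_rpow (p := 2) (by norm_num) (coeffs f) s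
  simpa using h

theorem sum_mul_sq_le (f : PeriodicSpace l hl d) (x : UnitAddTorus (Fin d))
    (s : Finset (Index l d)) :
    (∑ k ∈ s, coeffs f k * psiTensor l k.1 x) ^ 2 ≤ ‖f‖ ^ 2 * (∑' k, l k ^ 2) ^ d :=
  (Finset.sum_mul_sq_le_sq_mul_sq s _ _).trans
    (mul_le_mul (sum_coeffs_sq_le f s) (sum_index_sq_le hl x s)
      (Finset.sum_nonneg fun _ _ => sq_nonneg _) (sq_nonneg _))

theorem eval_sq_le (f : PeriodicSpace l hl d) (x : UnitAddTorus (Fin d)) :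
    evalCLM x f ^ 2 ≤ ‖f‖ ^ 2 * (∑' k, l k ^ 2) ^ d :=
  le_of_tendsto ((hasSum_eval f x).pow 2) (Filter.Eventually.of_forall (sum_mul_sq_le f x))

theorem abs_eval_le (f : PeriodicSpace l hl d) (x : UnitAddTorus (Fin d)) :
    |evalCLM x f| ≤ √((∑' k, l k ^ 2) ^ d) * ‖f‖ := by
  have hS : 0 ≤ (∑' k, l k ^ 2) ^ d := pow_nonneg (tsum_nonneg fun _ => sq_nonneg _) d
  refine abs_le_of_sq_le_sq ?_ (by positivity)
  rw [mul_pow, Real.sq_sqrt hS, mul_comm]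
  exact eval_sq_le f x

theorem eval_injective (f : PeriodicSpace l hl d)
    (hf : ∀ x : UnitAddTorus (Fin d), evalCLM x f = 0) : f = 0 := by
  have hcoeff : ∀ m : Index l d, coeffs f m = 0 := by
    intro m
    set M : ℝ := (∑' k, l k ^ 2) ^ d with hM
    have hlim : Filter.Tendsto (fun s : Finset (Index l d) => ∫ x : UnitAddTorus (Fin d),
        (∑ k ∈ s, coeffs f k * psiTensor l k.1 x) * psiTensor l m.1 x) Filter.atTop
        (nhds (∫ _x : UnitAddTorus (Fin d), (0 : ℝ))) := by
      refine tendsto_integral_filter_of_dominated_convergence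
        (fun _ => (1 + ‖f‖ ^ 2 * M) * (1 + M)) ?_ ?_ (integrable_const _) ?_
      · refine Filter.Eventually.of_forall fun s => Continuous.aestronglyMeasurable ?_
        exact (continuous_finsetSum _ fun k _ =>
          continuous_const.mul (continuous_psiTensor l k.1)).mul (continuous_psiTensor l m.1)
      · refine Filter.Eventually.of_forall fun s => Filter.Eventually.of_forall fun x => ?_
        have h1 := sum_mul_sq_le f x s
        have h2 := sum_index_sq_le hl x {m}
        rw [Finset.sum_singleton] at h2
        rw [Real.norm_eq_abs, abs_mul]
        refine mul_le_mul ?_ ?_ (abs_nonneg _) ?_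
        · refine abs_le.2 ⟨?_, ?_⟩ <;>
            nlinarith [sq_nonneg (∑ k ∈ s, coeffs f k * psiTensor l k.1 x - 1),
              sq_nonneg (∑ k ∈ s, coeffs f k * psiTensor l k.1 x + 1)]
        · refine abs_le.2 ⟨?_, ?_⟩ <;>
            nlinarith [sq_nonneg (psiTensor l m.1 x - 1), sq_nonneg (psiTensor l m.1 x + 1)]
        · have := (sq_nonneg _).trans h1
          linarith
      · refine Filter.Eventually.of_forall fun x => ?_
        have h := (hasSum_eval f x).mul_const (psiTensor l m.1 x)
        rw [hf x, zero_mul] at h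
        exact h
    have hev : ∀ s : Finset (Index l d), m ∈ s → ∫ x : UnitAddTorus (Fin d),
        (∑ k ∈ s, coeffs f k * psiTensor l k.1 x) * psiTensor l m.1 x =
        coeffs f m * ∫ x : UnitAddTorus (Fin d), psiTensor l m.1 x * psiTensor l m.1 x := by
      intro s hs
      simp only [Finset.sum_mul, mul_assoc]
      rw [integral_finsetSum]
      · rw [Finset.sum_eq_single m]
        · rw [integral_const_mul]
        · intro k _ hk
          rw [integral_const_mul, integral_psiTensor_mul l (fun h => hk (Subtype.ext h)), mul_zero]
        · exact fun h => (h hs).elim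
      · intro k _
        exact (continuous_const.mul ((continuous_psiTensor l k.1).mul
          (continuous_psiTensor l m.1))).integrable_of_hasCompactSupport
          (HasCompactSupport.of_compactSpace _)
    have hconst := tendsto_nhds_unique hlim (tendsto_const_nhds.congr' (Filter.EventuallyEq.symm
      ((Filter.eventually_ge_atTop {m}).mono fun s hs => hev s (hs (Finset.mem_singleton_self m)))))
    rw [integral_zero] at hconst
    exact (mul_eq_zero.1 hconst.symm).resolve_right (integral_psiTensor_sq_pos l m.2).ne'
  apply coeffs.injective
  rw [map_zero]
  exact lp.ext (funext hcoeff)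

/-- The elements of `H_λ(𝕋^d)` are functions on the torus: the element with coefficients `c` is the
function `x ↦ ∑_k c_k ψ_k(x)`.  Point evaluations are continuous. -/
instance instRKHS : RKHS ℝ (PeriodicSpace l hl d) (UnitAddTorus (Fin d)) ℝ where
  coeCLM := ContinuousLinearMap.pi evalCLM
  coeCLM_injective := (injective_iff_map_eq_zero _).2 fun f hf =>
    eval_injective f fun x => congrFun hf x

theorem coe_eq_tsum (f : PeriodicSpace l hl d) (x : UnitAddTorus (Fin d)) :
    f x = ∑' k : Index l d, coeffs f k * psiTensor l k.1 x :=
  (hasSum_eval f x).tsum_eq.symm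

/-- The orthonormal basis `{ψ_k} ∖ {0}` of `H_λ(𝕋^d)`, see `coe_basis`. -/
def basis : HilbertBasis (Index l d) ℝ (PeriodicSpace l hl d) := HilbertBasis.ofRepr coeffs

theorem coe_basis (k : Index l d) :
    ((basis k : PeriodicSpace l hl d) : UnitAddTorus (Fin d) → ℝ) = psiTensor l k.1 := by
  classical
  funext x
  have h : coeffs (basis k : PeriodicSpace l hl d) = lp.single 2 k (1 : ℝ) :=
    basis.repr_self k
  rw [coe_eq_tsum, h, tsum_eq_single k]
  · simp
  · intro m hm
    simp [lp.single_apply, hm]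

theorem memLp_top (f : PeriodicSpace l hl d) :
    MemLp (f : UnitAddTorus (Fin d) → ℝ) ∞ := by
  refine memLp_top_of_bound ?_ _ (Filter.Eventually.of_forall (abs_eval_le f))
  refine aestronglyMeasurable_of_tendsto_ae (Filter.atTop : Filter (Finset (Index l d)))
    (f := fun s x => ∑ k ∈ s, coeffs f k * psiTensor l k.1 x) (fun s => ?_)
    (Filter.Eventually.of_forall fun x => hasSum_eval f x)
  exact (continuous_finsetSum _ fun k _ =>
    continuous_const.mul (continuous_psiTensor l k.1)).aestronglyMeasurable

end Space

/-- The embedding `App : H_λ(𝕋^d) ↪ L_∞(𝕋^d)`, `f ↦ f`. -/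
def app (l : ℕ → ℝ) (hl : Summable fun k => l k ^ 2) (d : ℕ) :
    PeriodicSpace l hl d →L[ℝ] Lp ℝ ∞ (volume : Measure (UnitAddTorus (Fin d))) :=
  LinearMap.mkContinuous
    { toFun := fun f => (memLp_top f).toLp (f : UnitAddTorus (Fin d) → ℝ)
      map_add' := fun f g => by
        rw [← MemLp.toLp_add (memLp_top f) (memLp_top g)]
        exact MemLp.toLp_congr _ _ (Filter.Eventually.of_forall fun x => by simp)
      map_smul' := fun c f => by
        rw [RingHom.id_apply, ← MemLp.toLp_const_smul c (memLp_top f)]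
        exact MemLp.toLp_congr _ _ (Filter.Eventually.of_forall fun x => by simp) }
    (√((∑' k, l k ^ 2) ^ d)) fun f => by
      refine (Lp.norm_toLp _ (memLp_top f)).trans_le
        (ENNReal.toReal_le_of_le_ofReal (mul_nonneg (Real.sqrt_nonneg _) (norm_nonneg _)) ?_)
      rw [eLpNorm_exponent_top]
      exact eLpNormEssSup_le_of_ae_bound (Filter.Eventually.of_forall (abs_eval_le f))

theorem coeFn_app {l : ℕ → ℝ} {hl : Summable fun k => l k ^ 2} {d : ℕ}
    (f : PeriodicSpace l hl d) :
    (app l hl d f : UnitAddTorus (Fin d) → ℝ) =ᵐ[volume] f :=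
  MemLp.coeFn_toLp (memLp_top f)

end PeriodicTensor

end

/-! Adaption does not help on a symmetric ball. If `f` is annihilated by the functionals an
algorithm uses after observing only zeros, then `f` and `-f` yield the same output, so the error is
at least the norm of the solution at `f` (`DetAlgorithm.enorm_le_error`). It remains to find, for
any `n` functionals, such an `f` in the unit ball with large sup norm (`exists_fooling`).

Let `U` be the span of their Riesz representers, with orthonormal basis `b_i`, and let `K` be the
reproducing kernel. The kernel of the orthogonal complement of `U` has diagonal `K(x,x) - ∑
b_i(x)²`. Since `cos² + sin² = 1`, `K(x,x) = (∑ λ_k²)^d = 1` for every `x`. The `ψ_k` are orthogonal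
in `L_2` with squared norms at most `β^d`, so each `b_i²` has mean at most `β^d`. Averaging over
`x`, some diagonal value is at least `1 - n β^d`. Normalising the projection of `K(x,·)` gives a
function whose value at `x` is the root of that diagonal value; continuity makes this a lower bound
for its `L_∞` norm. As `β < 1`, the cardinality must grow like `β^{-d}`. -/

noncomputable section

/-! ### Adaptive algorithms and symmetric inputs -/

namespace IBC

namespace DetAlgorithm

variable {E G : Type*} [NormedAddCommGroup E] [NormedSpace ℝ E] {n : ℕ}

/-- If all functionals evaluated after observing zeros vanish at `f`, then the information
about `f` is zero. -/
theorem info_eq_zero (A : DetAlgorithm E G n) (f : E) :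
    ∀ m : ℕ, (∀ k < m, A.functional k 0 f = 0) → A.info f m = 0
  | 0, _ => Subsingleton.elim _ _
  | m + 1, h => by
    have ih := info_eq_zero A f m fun k hk => h k (hk.trans m.lt_succ_self)
    rw [info, ih, h m m.lt_succ_self]
    funext i
    refine Fin.lastCases ?_ (fun j => ?_) i <;> simp

/-- The worst case error on the unit ball is bounded below by the norm of the solution at any
element of the unit ball with vanishing information. -/
theorem enorm_le_error {G : Type*} [NormedAddCommGroup G] [NormedSpace ℝ G]
    (A : DetAlgorithm E G n) (S : E →L[ℝ] G) {f : E} (hf : ‖f‖ ≤ 1)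
    (h : ∀ k < n, A.functional k 0 f = 0) :
    ‖S f‖ₑ ≤ A.error S (Metric.closedBall 0 1) := by
  -- Both inputs produce zero information, so one output must serve two solutions at distance `2 *
  -- ‖S f‖ₑ`.
  have hrun : A.run (-f) = A.run f := by
    rw [run, run, info_eq_zero A f n h, info_eq_zero A (-f) n fun k hk => by simp [h k hk]]
  have le_err : ∀ g : E, ‖g‖ ≤ 1 →
      edist (A.run g) (S g) ≤ A.error S (Metric.closedBall 0 1) := fun g hg =>
    le_iSup₂ (f := fun g _ => edist (A.run g) (S g)) g (by simpa using hg)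
  have h1 := le_err f hf
  have h2 := le_err (-f) (by simpa using hf)
  rw [hrun] at h2
  have h3 : edist (S f) (S (-f)) = 2 * ‖S f‖ₑ := by
    rw [edist_eq_enorm_sub, map_neg, sub_neg_eq_add, ← two_smul ℝ, enorm_smul]
    congr 1
    simp [Real.enorm_eq_ofReal]
  have h4 : 2 * ‖S f‖ₑ ≤ 2 * A.error S (Metric.closedBall 0 1) := by
    rw [← h3, two_mul]
    exact (edist_triangle_left _ _ (A.run f)).trans (add_le_add h1 h2)
  exact (ENNReal.mul_le_mul_iff_right (by simp) (by simp)).1 h4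

end DetAlgorithm

end IBC

/-! ### `L_2` norms of the tensor product system -/

namespace PeriodicTensor

open MeasureTheory Filter

theorem integral_psi_sq (l : ℕ → ℝ) (k : ℤ) :
    ∫ x : UnitAddCircle, psi l k x ^ 2 =
      if k = 0 then l 0 ^ 2 else l k.natAbs ^ 2 / 2 := by
  by_cases hk : k = 0
  · subst hk
    simp [psi, cosT_zero, measureReal_def]
  -- Half-angle formulas: `s = 1` gives the squared cosine and `s = -1` the squared sine; the term
  -- of frequency `2|k| ≠ 0` has mean zero.
  have key : ∀ a s : ℝ, ∫ x : UnitAddCircle,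
      (a ^ 2 / 2 + a ^ 2 / 2 * s * (fourier ((k.natAbs : ℤ) + k.natAbs) x : ℂ).re) =
        a ^ 2 / 2 := by
    intro a s
    have hint : Integrable fun x : UnitAddCircle =>
        a ^ 2 / 2 * s * (fourier ((k.natAbs : ℤ) + k.natAbs) x : ℂ).re :=
      (integrable_fourier _).re.const_mul _
    rw [integral_add (integrable_const _) hint,
      integral_const_mul, integral_fourier_re, if_neg (by omega)]
    simp [measureReal_def]
  have hre : ∀ x : UnitAddCircle, (fourier ((k.natAbs : ℤ) + k.natAbs) x : ℂ).re =
      cosT k.natAbs x ^ 2 - sinT k.natAbs x ^ 2 := fun x => by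
    rw [fourier_add, Complex.mul_re, cosT, sinT]
    ring
  rw [if_neg hk]
  by_cases h : 0 ≤ k
  · rw [← key (l k.natAbs) 1]
    refine integral_congr_ae (Eventually.of_forall fun x => ?_)
    have := cosT_sq_add_sinT_sq k.natAbs x
    simp only [psi, if_pos h, hre]
    linear_combination (l k.natAbs ^ 2 / 2) * this
  · rw [← key (l k.natAbs) (-1)]
    refine integral_congr_ae (Eventually.of_forall fun x => ?_)
    have := cosT_sq_add_sinT_sq k.natAbs x
    simp only [psi, if_neg h, hre]
    linear_combination (l k.natAbs ^ 2 / 2) * this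

theorem integral_psiTensor_sq_le {l : ℕ → ℝ} {β : ℝ} (h0 : l 0 ^ 2 ≤ β)
    (h1 : ∀ k : ℕ, 1 ≤ k → l k ^ 2 / 2 ≤ β) {d : ℕ} (k : Fin d → ℤ) :
    ∫ x : UnitAddTorus (Fin d), psiTensor l k x * psiTensor l k x ≤ β ^ d := by
  have e : ∀ x : UnitAddTorus (Fin d),
      psiTensor l k x * psiTensor l k x = ∏ j, psi l (k j) (x j) ^ 2 := fun x => by
    rw [psiTensor, ← pow_two, Finset.prod_pow]
  simp only [e]
  rw [integral_fintype_prod_volume_eq_prod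
    (fun (j : Fin d) (y : UnitAddCircle) => psi l (k j) y ^ 2)]
  calc ∏ j, ∫ y : UnitAddCircle, psi l (k j) y ^ 2 ≤ ∏ _j : Fin d, β := by
        refine Finset.prod_le_prod (fun j _ => integral_nonneg fun _ => sq_nonneg _) fun j _ => ?_
        rw [integral_psi_sq]
        split_ifs with h
        · exact h0
        · exact h1 _ (by omega)
    _ = β ^ d := by simp

instance isProbabilityMeasure_unitAddCircle :
    IsProbabilityMeasure (volume : Measure UnitAddCircle) :=
  ⟨UnitAddCircle.measure_univ⟩

instance isProbabilityMeasure_unitAddTorus (d : ℕ) :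
    IsProbabilityMeasure (volume : Measure (UnitAddTorus (Fin d))) :=
  inferInstanceAs (IsProbabilityMeasure (Measure.pi fun _ : Fin d => volume))

/-! ### Continuity and the sup norm -/

section Space

variable {l : ℕ → ℝ} {hl : Summable fun k => l k ^ 2} {d : ℕ}

theorem coe_eq_evalCLM (f : PeriodicSpace l hl d) (x : UnitAddTorus (Fin d)) :
    f x = evalCLM x f := rfl

/-- The elements of `H_λ(𝕋^d)` are continuous functions. -/
theorem continuous_coe (f : PeriodicSpace l hl d) :
    Continuous (f : UnitAddTorus (Fin d) → ℝ) := by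
  -- Point evaluations are bounded uniformly in `x`, so norm limits are uniform limits and preserve
  -- continuity. Finite combinations of the basis are continuous and dense.
  have hclosed : IsClosed {g : PeriodicSpace l hl d |
      Continuous (g : UnitAddTorus (Fin d) → ℝ)} := by
    refine isClosed_of_closure_subset fun g hg => ?_
    refine continuous_of_uniform_approx_of_continuous fun u hu => ?_
    obtain ⟨ε, hε, hεu⟩ := Metric.mem_uniformity_dist.1 hu
    set C : ℝ := √((∑' k, l k ^ 2) ^ d)
    have hC0 : 0 ≤ C := Real.sqrt_nonneg _
    obtain ⟨g', hg', hd⟩ := Metric.mem_closure_iff.1 hg (ε / (C + 1)) (by positivity)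
    refine ⟨g', hg', fun x => hεu ?_⟩
    rw [Real.dist_eq, coe_eq_evalCLM, coe_eq_evalCLM, ← map_sub]
    rw [dist_eq_norm, lt_div_iff₀ (by positivity)] at hd
    have := abs_eval_le (g - g') x
    nlinarith [norm_nonneg (g - g')]
  refine hclosed.mem_of_tendsto (basis.hasSum_repr f) (Eventually.of_forall fun s => ?_)
  change Continuous fun x => evalCLM x (∑ k ∈ s, basis.repr f k • basis k)
  simp only [map_sum, map_smul, smul_eq_mul]
  refine continuous_finsetSum _ fun k _ => continuous_const.mul ?_
  have h : (fun x => evalCLM x (basis k : PeriodicSpace l hl d)) = psiTensor l k.1 := coe_basis k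
  rw [h]
  exact continuous_psiTensor l k.1

/-- The norm in `L_∞` dominates every value of the function. -/
theorem abs_coe_le_norm_app (f : PeriodicSpace l hl d) (x : UnitAddTorus (Fin d)) :
    |f x| ≤ ‖app l hl d f‖ := by
  have hae : ∀ᵐ y : UnitAddTorus (Fin d), |f y| ≤ ‖app l hl d f‖ := by
    filter_upwards [coeFn_app f, ae_le_eLpNormEssSup (f := app l hl d f)
      (μ := (volume : Measure (UnitAddTorus (Fin d))))] with y hy hle
    rw [← eLpNorm_exponent_top] at hle
    have := ENNReal.toReal_mono (Lp.eLpNorm_ne_top _) hle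
    rw [toReal_enorm, hy] at this
    exact this
  -- The exceptional set is open and null, hence empty, because the volume charges every nonempty
  -- open set.
  have hopen : IsOpen {y | |f y| ≤ ‖app l hl d f‖}ᶜ := by
    simp only [Set.compl_ofPred, not_le]
    exact isOpen_lt continuous_const (continuous_coe f).abs
  have hempty := hopen.measure_eq_zero_iff volume |>.1 hae
  by_contra hx
  exact Set.notMem_empty x (hempty ▸ (show x ∈ {y | |f y| ≤ ‖app l hl d f‖}ᶜ from hx))

theorem norm_app_le (hsum : ∑' k, l k ^ 2 = 1) (f : PeriodicSpace l hl d) :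
    ‖app l hl d f‖ ≤ ‖f‖ := by
  have h := (app l hl d).le_opNorm f
  have h1 : ‖app l hl d‖ ≤ √((∑' k, l k ^ 2) ^ d) :=
    LinearMap.mkContinuous_norm_le _ (Real.sqrt_nonneg _) _
  rw [hsum, one_pow, Real.sqrt_one] at h1
  nlinarith [norm_nonneg f]

/-! ### The reproducing kernel and its diagonal -/

/-- The reproducing kernel of `H_λ(𝕋^d)` at `x`. -/
def kernelAt (l : ℕ → ℝ) (hl : Summable fun k => l k ^ 2) (d : ℕ) (x : UnitAddTorus (Fin d)) :
    PeriodicSpace l hl d :=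
  coeffs.symm (feature l hl d x)

theorem inner_kernelAt (x : UnitAddTorus (Fin d)) (f : PeriodicSpace l hl d) :
    inner ℝ (kernelAt l hl d x) f = f x := by
  rw [kernelAt, LinearIsometryEquiv.inner_map_eq_flip, LinearIsometryEquiv.symm_symm]
  rfl

/-- The diagonal of the reproducing kernel is bounded below by `(∑ λ_k²)^d`. -/
theorem le_norm_kernelAt_sq (x : UnitAddTorus (Fin d)) :
    (∑' k, l k ^ 2) ^ d ≤ ‖kernelAt l hl d x‖ ^ 2 := by
  classical
  -- Over a box of multi-indices the sum of squares factorises into univariate sums, whose limits do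
  -- not depend on `x`.
  have hlim : Tendsto (fun s : Finset ℤ => ∏ j : Fin d, ∑ i ∈ s, psi l i (x j) ^ 2) atTop
      (nhds (∏ _j : Fin d, ∑' k, l k ^ 2)) :=
    tendsto_finsetProd _ fun j _ => hasSum_psi_sq hl (x j)
  rw [Finset.prod_const, Finset.card_univ, Fintype.card_fin] at hlim
  refine le_of_tendsto hlim (Eventually.of_forall fun s => ?_)
  rw [Finset.prod_univ_sum]
  -- Discarding the multi-indices outside `Index l d` costs nothing: their functions vanish
  -- identically.
  have h := sum_coeffs_sq_le (kernelAt l hl d x)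
    ((Fintype.piFinset fun _ : Fin d => s).subtype fun k => psiTensor l k ≠ 0)
  refine le_trans (le_of_eq ?_) h
  have hc : ∀ k : Index l d, coeffs (kernelAt l hl d x) k = psiTensor l k.1 x := fun k => rfl
  simp only [hc]
  rw [Finset.sum_subtype_eq_sum_filter (f := fun k => psiTensor l k x ^ 2), Finset.sum_filter]
  refine Finset.sum_congr rfl fun k _ => ?_
  split_ifs with hk
  · rw [psiTensor, Finset.prod_pow]
  · rw [Finset.prod_pow, ← psiTensor, not_not.1 hk]
    simp

/-! ### The embedding into `L_2` -/

/-- Orthogonality in `L_2` removes the mixed terms of the expanded square, and each remaining one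
carries a factor of at most `β ^ d`. -/
theorem integral_sum_sq_le {β : ℝ} (h0 : l 0 ^ 2 ≤ β)
    (h1 : ∀ k : ℕ, 1 ≤ k → l k ^ 2 / 2 ≤ β) (c : Index l d → ℝ) (s : Finset (Index l d)) :
    ∫ x : UnitAddTorus (Fin d), (∑ k ∈ s, c k * psiTensor l k.1 x) ^ 2 ≤
      β ^ d * ∑ k ∈ s, c k ^ 2 := by
  classical
  have hint : ∀ (a : ℝ) (k m : Index l d), Integrable fun x : UnitAddTorus (Fin d) =>
      a * (psiTensor l k.1 x * psiTensor l m.1 x) := fun a k m =>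
    (continuous_const.mul ((continuous_psiTensor l k.1).mul
      (continuous_psiTensor l m.1))).integrable_of_hasCompactSupport
      (HasCompactSupport.of_compactSpace _)
  have e : ∀ x : UnitAddTorus (Fin d), (∑ k ∈ s, c k * psiTensor l k.1 x) ^ 2 =
      ∑ k ∈ s, ∑ m ∈ s, c k * c m * (psiTensor l k.1 x * psiTensor l m.1 x) := fun x => by
    rw [pow_two, Finset.sum_mul_sum]
    exact Finset.sum_congr rfl fun _ _ => Finset.sum_congr rfl fun _ _ => by ring
  simp only [e]
  rw [integral_finsetSum _ fun k _ => integrable_finsetSum _ fun m _ => hint _ k m,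
    Finset.mul_sum]
  refine Finset.sum_le_sum fun k hk => ?_
  rw [integral_finsetSum _ fun m _ => hint _ k m, Finset.sum_eq_single_of_mem k hk]
  · rw [integral_const_mul]
    nlinarith [integral_psiTensor_sq_le h0 h1 k.1, sq_nonneg (c k)]
  · intro m _ hm
    rw [integral_const_mul, integral_psiTensor_mul l (fun h => hm (Subtype.ext h.symm)), mul_zero]

/-- The embedding of `H_λ(𝕋^d)` into `L_2(𝕋^d)` has squared norm at most `β ^ d`. -/
theorem integral_coe_sq_le {β : ℝ} (h0 : l 0 ^ 2 ≤ β)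
    (h1 : ∀ k : ℕ, 1 ≤ k → l k ^ 2 / 2 ≤ β) (f : PeriodicSpace l hl d) :
    ∫ x : UnitAddTorus (Fin d), f x ^ 2 ≤ β ^ d * ‖f‖ ^ 2 := by
  have hβ : 0 ≤ β := (sq_nonneg _).trans h0
  have hlim : Tendsto (fun s : Finset (Index l d) => ∫ x : UnitAddTorus (Fin d),
      (∑ k ∈ s, coeffs f k * psiTensor l k.1 x) ^ 2) atTop
      (nhds (∫ x : UnitAddTorus (Fin d), f x ^ 2)) := by
    refine tendsto_integral_filter_of_dominated_convergence
      (fun _ => ‖f‖ ^ 2 * (∑' k, l k ^ 2) ^ d) ?_ ?_ (integrable_const _) ?_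
    · exact Eventually.of_forall fun s => Continuous.aestronglyMeasurable
        ((continuous_finsetSum _ fun k _ =>
          continuous_const.mul (continuous_psiTensor l k.1)).pow 2)
    · refine Eventually.of_forall fun s => Eventually.of_forall fun x => ?_
      rw [Real.norm_of_nonneg (sq_nonneg _)]
      exact sum_mul_sq_le f x s
    · exact Eventually.of_forall fun x => (hasSum_eval f x).pow 2
  exact le_of_tendsto hlim (Eventually.of_forall fun s =>
    (integral_sum_sq_le h0 h1 _ s).trans
      (mul_le_mul_of_nonneg_left (sum_coeffs_sq_le f s) (pow_nonneg hβ d)))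

/-! ### Fooling functions by averaging the kernel diagonal -/

/-- The projection of the kernel function `K(x, ·)` onto `Uᗮ`, evaluated at `x`, equals its
squared norm. -/
theorem coe_sub_starProjection_kernelAt (U : Submodule ℝ (PeriodicSpace l hl d))
    [U.HasOrthogonalProjection] (x : UnitAddTorus (Fin d)) :
    (kernelAt l hl d x - U.starProjection (kernelAt l hl d x)) x =
      ‖kernelAt l hl d x - U.starProjection (kernelAt l hl d x)‖ ^ 2 := by
  have h : inner ℝ (U.starProjection (kernelAt l hl d x))
      (kernelAt l hl d x - U.starProjection (kernelAt l hl d x)) = 0 :=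
    U.inner_right_of_mem_orthogonal (U.starProjection_apply_mem _)
      (U.sub_starProjection_mem_orthogonal _)
  rw [← inner_kernelAt, ← real_inner_self_eq_norm_sq]
  conv_rhs => rw [inner_sub_left, h, sub_zero]

/-- Averaging argument: the kernel of `Uᗮ` is large somewhere on the diagonal. -/
theorem exists_le_norm_sub_starProjection_sq (hsum : ∑' k, l k ^ 2 = 1) {β : ℝ}
    (h0 : l 0 ^ 2 ≤ β) (h1 : ∀ k : ℕ, 1 ≤ k → l k ^ 2 / 2 ≤ β)
    (U : Submodule ℝ (PeriodicSpace l hl d)) [FiniteDimensional ℝ U] :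
    ∃ x : UnitAddTorus (Fin d), 1 - Module.finrank ℝ U * β ^ d ≤
      ‖kernelAt l hl d x - U.starProjection (kernelAt l hl d x)‖ ^ 2 := by
  set b := stdOrthonormalBasis ℝ U
  have hint : ∀ i, Integrable fun x : UnitAddTorus (Fin d) =>
      ((b i : PeriodicSpace l hl d) x) ^ 2 := fun i =>
    ((continuous_coe _).pow 2).integrable_of_hasCompactSupport (HasCompactSupport.of_compactSpace _)
  have hint' : Integrable fun x : UnitAddTorus (Fin d) =>
      1 - ∑ i, ((b i : PeriodicSpace l hl d) x) ^ 2 :=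
    (integrable_const _).sub (integrable_finsetSum _ fun i _ => hint i)
  -- On a probability space some value is at least the mean.
  obtain ⟨x, hx⟩ := exists_integral_le hint'
  refine ⟨x, ?_⟩
  rw [integral_sub (integrable_const _) (integrable_finsetSum _ fun i _ => hint i),
    integral_finsetSum _ fun i _ => hint i] at hx
  have hle : ∑ i, ∫ y : UnitAddTorus (Fin d), ((b i : PeriodicSpace l hl d) y) ^ 2 ≤
      Module.finrank ℝ U * β ^ d := by
    refine (Finset.sum_le_card_nsmul _ _ (β ^ d) fun i _ => ?_).trans_eq (by simp)
    have := integral_coe_sq_le h0 h1 (b i : PeriodicSpace l hl d)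
    rwa [← Submodule.coe_norm, b.norm_eq_one, one_pow, mul_one] at this
  -- Parseval in `U`; by the reproducing property the coefficients of `K(x,·)` are the values
  -- `b_i(x)`.
  have hproj : ‖U.starProjection (kernelAt l hl d x)‖ ^ 2 =
      ∑ i, ((b i : PeriodicSpace l hl d) x) ^ 2 := by
    rw [U.starProjection_apply, ← Submodule.coe_norm, ← b.sum_sq_norm_inner_left]
    refine Finset.sum_congr rfl fun i _ => ?_
    rw [Submodule.inner_orthogonalProjectionOnto_eq_of_mem_right, inner_kernelAt, Real.norm_eq_abs,
      sq_abs]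
  have hpyth : ‖kernelAt l hl d x‖ ^ 2 = ‖U.starProjection (kernelAt l hl d x)‖ ^ 2 +
      ‖kernelAt l hl d x - U.starProjection (kernelAt l hl d x)‖ ^ 2 := by
    have h : inner ℝ (U.starProjection (kernelAt l hl d x))
        (kernelAt l hl d x - U.starProjection (kernelAt l hl d x)) = 0 :=
      U.inner_right_of_mem_orthogonal (U.starProjection_apply_mem _)
        (U.sub_starProjection_mem_orthogonal _)
    have := norm_add_sq_eq_norm_sq_add_norm_sq_of_inner_eq_zero _ _ h
    rw [add_sub_cancel] at this
    nlinarith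
  have hK := le_norm_kernelAt_sq (hl := hl) x
  rw [hsum, one_pow] at hK
  have hone : ∫ _y : UnitAddTorus (Fin d), (1 : ℝ) = 1 := by simp
  rw [hone] at hx
  linarith

/-- For any `n` continuous functionals there is an element of the unit ball in their common kernel
with large norm in `L_∞`. -/
theorem exists_fooling (hsum : ∑' k, l k ^ 2 = 1) {β : ℝ}
    (h0 : l 0 ^ 2 ≤ β) (h1 : ∀ k : ℕ, 1 ≤ k → l k ^ 2 / 2 ≤ β) {n : ℕ}
    (L : Fin n → PeriodicSpace l hl d →L[ℝ] ℝ) :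
    ∃ f : PeriodicSpace l hl d, ‖f‖ ≤ 1 ∧ (∀ i, L i f = 0) ∧
      √(1 - n * β ^ d) ≤ ‖app l hl d f‖ := by
  have hβ : 0 ≤ β := (sq_nonneg _).trans h0
  set r : Fin n → PeriodicSpace l hl d := fun i => (InnerProductSpace.toDual ℝ _).symm (L i)
  set U : Submodule ℝ (PeriodicSpace l hl d) := Submodule.span ℝ (Set.range r)
  have : FiniteDimensional ℝ U := FiniteDimensional.span_of_finite ℝ (Set.finite_range r)
  have hrank : Module.finrank ℝ U ≤ n := (finrank_range_le_card r).trans_eq (Fintype.card_fin n)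
  obtain ⟨x, hx⟩ := exists_le_norm_sub_starProjection_sq hsum h0 h1 U
  have hval := coe_sub_starProjection_kernelAt U x
  have hmem := U.sub_starProjection_mem_orthogonal (kernelAt l hl d x)
  set g := kernelAt l hl d x - U.starProjection (kernelAt l hl d x)
  -- If `g = 0`, the inverse is `0` by convention and the witness is zero; the bound then holds
  -- because `√(1 - n * β ^ d) ≤ ‖g‖ = 0`.
  refine ⟨‖g‖⁻¹ • g, ?_, fun i => ?_, ?_⟩
  · rw [norm_smul, norm_inv, norm_norm]
    exact inv_mul_le_one
  · have h : inner ℝ (r i) g = 0 :=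
      U.inner_right_of_mem_orthogonal (Submodule.subset_span (Set.mem_range_self i)) hmem
    rw [InnerProductSpace.toDual_symm_apply] at h
    rw [map_smul, h, smul_zero]
  · have hle : √(1 - n * β ^ d) ≤ ‖g‖ := by
      refine Real.sqrt_le_iff.2 ⟨norm_nonneg _, le_trans ?_ hx⟩
      have : (Module.finrank ℝ U : ℝ) ≤ n := by exact_mod_cast hrank
      nlinarith [pow_nonneg hβ d]
    have hv : (‖g‖⁻¹ • g) x = ‖g‖ := by
      rw [coe_eq_evalCLM, map_smul, ← coe_eq_evalCLM, hval, smul_eq_mul]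
      rcases eq_or_ne ‖g‖ 0 with h | h
      · simp [h]
      · field_simp
    have := abs_coe_le_norm_app (‖g‖⁻¹ • g) x
    rw [hv, abs_norm] at this
    exact hle.trans this

/-! ### Bounds for errors and complexity -/

theorem le_error (hsum : ∑' k, l k ^ 2 = 1) {β : ℝ}
    (h0 : l 0 ^ 2 ≤ β) (h1 : ∀ k : ℕ, 1 ≤ k → l k ^ 2 / 2 ≤ β) {n : ℕ}
    (A : IBC.DetAlgorithm (PeriodicSpace l hl d)
      (Lp ℝ ∞ (volume : Measure (UnitAddTorus (Fin d)))) n) :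
    ENNReal.ofReal (√(1 - n * β ^ d)) ≤ A.error (app l hl d) (Metric.closedBall 0 1) := by
  obtain ⟨f, hf, hL, hnorm⟩ := exists_fooling hsum h0 h1 (hl := hl) (d := d)
    fun i : Fin n => A.functional i 0
  refine le_trans ?_ (A.enorm_le_error (app l hl d) hf fun k hk => hL ⟨k, hk⟩)
  rw [← ofReal_norm]
  exact ENNReal.ofReal_le_ofReal hnorm

theorem detError_zero_le (hsum : ∑' k, l k ^ 2 = 1) :
    IBC.detError (app l hl d) (Metric.closedBall 0 1) 0 ≤ 1 := by
  -- The algorithm that always outputs zero.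
  refine (iInf_le _ ⟨fun _ _ => 0, fun _ => 0⟩).trans (iSup₂_le fun f hf => ?_)
  rw [IBC.DetAlgorithm.run, edist_comm, edist_zero_right, ← ofReal_norm, ENNReal.ofReal_le_one]
  exact (norm_app_le hsum f).trans (by simpa using hf)

/-- Error at most `ε` forces `n β^d ≥ 1 - ε²`, and `1 - ε² ≥ (1 - ε)²` on `(0,1)`. The ceiling
carries the real bound into `ℕ∞`. -/
theorem le_detComplexity (hsum : ∑' k, l k ^ 2 = 1) {β : ℝ} (hβ : 0 < β)
    (h0 : l 0 ^ 2 ≤ β) (h1 : ∀ k : ℕ, 1 ≤ k → l k ^ 2 / 2 ≤ β) {ε : ℝ} (hε : 0 < ε)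
    (hε1 : ε < 1) :
    ENNReal.ofReal ((β ^ d)⁻¹ * (1 - ε) ^ 2) ≤
      (IBC.detComplexity (app l hl d) (Metric.closedBall 0 1) ε : ℝ≥0∞) := by
  have hle : ((⌈(β ^ d)⁻¹ * (1 - ε) ^ 2⌉₊ : ℕ) : ℕ∞) ≤
      IBC.detComplexity (app l hl d) (Metric.closedBall 0 1) ε := by
    refine le_iInf₂ fun n ⟨A, hA⟩ => ?_
    have h := (ENNReal.ofReal_le_ofReal_iff hε.le).1 ((le_error hsum h0 h1 A).trans hA)
    have hsq := (Real.sqrt_le_iff.1 h).2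
    have hp : 0 < β ^ d := pow_pos hβ d
    refine Nat.cast_le.2 (Nat.ceil_le.2 ?_)
    rw [inv_mul_le_iff₀ hp]
    nlinarith
  calc ENNReal.ofReal ((β ^ d)⁻¹ * (1 - ε) ^ 2)
      ≤ ENNReal.ofReal (⌈(β ^ d)⁻¹ * (1 - ε) ^ 2⌉₊ : ℝ) :=
        ENNReal.ofReal_le_ofReal (Nat.le_ceil _)
    _ = (((⌈(β ^ d)⁻¹ * (1 - ε) ^ 2⌉₊ : ℕ) : ℕ∞) : ℝ≥0∞) := by simp
    _ ≤ _ := ENat.toENNReal_le.2 hle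

end Space

/-- The largest squared `L_2`-norm of the functions `ψ_k` lies strictly between `0` and `1`. -/
theorem exists_isLUB_beta {l : ℕ → ℝ} (hnonneg : ∀ k, 0 ≤ l k) (hl0 : l 0 < 1)
    (hsum : HasSum (fun k => l k ^ 2) 1) :
    ∃ β : ℝ, IsLUB (insert (l 0 ^ 2) {b : ℝ | ∃ k : ℕ, 1 ≤ k ∧ b = l k ^ 2 / 2}) β ∧
      0 < β ∧ β < 1 := by
  -- Each `λ_k²` is at most the full sum `1`, so the terms with `k ≥ 1` stay below `1/2`; `λ_0 < 1`
  -- handles the other one.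
  have hub : max (l 0 ^ 2) (1 / 2) ∈
      upperBounds (insert (l 0 ^ 2) {b : ℝ | ∃ k : ℕ, 1 ≤ k ∧ b = l k ^ 2 / 2}) := by
    rintro b (rfl | ⟨k, -, rfl⟩)
    · exact le_max_left _ _
    · have := le_hasSum hsum k fun _ _ => sq_nonneg _
      exact le_max_of_le_right (by linarith)
  have hlub := isLUB_csSup ⟨_, Set.mem_insert _ _⟩ ⟨_, hub⟩
  refine ⟨_, hlub, ?_, (hlub.2 hub).trans_lt (max_lt ?_ (by norm_num))⟩
  -- If the supremum were not positive, all `λ_k` would vanish, against the sum being `1`.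
  · by_contra hneg
    rw [not_lt] at hneg
    have hz : ∀ k, l k ^ 2 = 0 := by
      intro k
      rcases Nat.eq_zero_or_pos k with rfl | hk
      · exact le_antisymm ((hlub.1 (Set.mem_insert _ _)).trans hneg) (sq_nonneg _)
      · have := (hlub.1 (Set.mem_insert_of_mem _ ⟨k, hk, rfl⟩)).trans hneg
        nlinarith [sq_nonneg (l k)]
    simp only [hz] at hsum
    exact one_ne_zero (hsum.unique hasSum_zero)
  · nlinarith [hnonneg 0]

end PeriodicTensor

end

theorem mainTheorem7 (l : ℕ → ℝ) (hnonneg : ∀ k, 0 ≤ l k) (hl0 : l 0 < 1)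
    (hsum : HasSum (fun k => l k ^ 2) 1) :
    -- the curse of dimensionality in the deterministic setting
    IBC.CurseOfDimensionality (fun ε d =>
      IBC.detComplexity (PeriodicTensor.app l hsum.summable d) (Metric.closedBall 0 1) ε) ∧
    -- the initial error is constant `1`
    (∀ d : ℕ, 1 ≤ d →
      IBC.detError (PeriodicTensor.app l hsum.summable d) (Metric.closedBall 0 1) 0 = 1) ∧
    ∃ β : ℝ, IsLUB (insert (l 0 ^ 2) {b : ℝ | ∃ k : ℕ, 1 ≤ k ∧ b = l k ^ 2 / 2}) β ∧
      0 < β ∧ β < 1 ∧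
      -- the lower bound for the minimal errors
      (∀ d : ℕ, 1 ≤ d → ∀ n : ℕ,
        ENNReal.ofReal (Real.sqrt (max (1 - n * β ^ d) 0)) ≤
          IBC.detError (PeriodicTensor.app l hsum.summable d) (Metric.closedBall 0 1) n) ∧
      -- the lower bound for the complexity
      (∀ d : ℕ, 1 ≤ d → ∀ ε : ℝ, 0 < ε → ε < 1 →
        ENNReal.ofReal ((β ^ d)⁻¹ * (1 - ε) ^ 2) ≤
          (IBC.detComplexity (PeriodicTensor.app l hsum.summable d)
            (Metric.closedBall 0 1) ε : ENNReal)) := by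
  have hs := hsum.tsum_eq
  obtain ⟨β, hlub, hβ0, hβ1⟩ := PeriodicTensor.exists_isLUB_beta hnonneg hl0 hsum
  have h0 : l 0 ^ 2 ≤ β := hlub.1 (Set.mem_insert _ _)
  have h1 : ∀ k : ℕ, 1 ≤ k → l k ^ 2 / 2 ≤ β := fun k hk =>
    hlub.1 (Set.mem_insert_of_mem _ ⟨k, hk, rfl⟩)
  have herr : ∀ d n : ℕ, ENNReal.ofReal (Real.sqrt (max (1 - n * β ^ d) 0)) ≤
      IBC.detError (PeriodicTensor.app l hsum.summable d) (Metric.closedBall 0 1) n := by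
    refine fun d n => le_iInf fun A => ?_
    have hmax : Real.sqrt (max (1 - n * β ^ d) 0) = Real.sqrt (1 - n * β ^ d) := by
      rcases le_total (1 - n * β ^ d) 0 with h | h
      · rw [max_eq_right h, Real.sqrt_eq_zero_of_nonpos h, Real.sqrt_zero]
      · rw [max_eq_left h]
    rw [hmax]
    exact PeriodicTensor.le_error hs h0 h1 A
  -- For `ε = 1/2` the complexity bound is `(1 - 1/2)² β^{-d}`, so `1 + γ = β⁻¹` and `c = 1/4`.
  refine ⟨⟨1 / 2, β⁻¹ - 1, 1 / 4, by norm_num, sub_pos.2 ((one_lt_inv₀ hβ0).2 hβ1), by norm_num,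
    1, fun d _ => ?_⟩, fun d _ => (PeriodicTensor.detError_zero_le hs).antisymm ?_,
    β, hlub, hβ0, hβ1, fun d _ n => herr d n, fun d _ ε hε hε1 =>
      PeriodicTensor.le_detComplexity hs hβ0 h0 h1 hε hε1⟩
  · have h := PeriodicTensor.le_detComplexity (hl := hsum.summable) (d := d) hs hβ0 h0 h1
      (ε := 1 / 2) (by norm_num) (by norm_num)
    refine le_trans (ENNReal.ofReal_le_ofReal (le_of_eq ?_)) h
    rw [add_sub_cancel, inv_pow]
    ring
  · simpa using herr d 0
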